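/- Let $G=(V,E,w)$ and $G'=(V,E',w')$ be finite simple undirected graphs on the same vertex set $V$, with positive real edge weights $w:E\to\mathbb{R}_{>0}$ and $w':E'\to\mathbb{R}_{>0}$, such that $E'\subseteq E$ and $G'$ is connected (hence $G$ is connected as well). Write $\deg(u)=\sum_{z:\{u,z\}\in E}w(u,z)$ for the weighted degree in $G$, $d_{\min}=\min_{u}\deg(u)$, $d_{\max}=\max_u\deg(u)$; let $L=D-A$ be the Laplacian of $G$ ($D$ the diagonal degree matrix, $A$ the weighted adjacency matrix), let $L'$ be the Laplacian of $G'$, and let $$\phi(G)=\min_{\emptyset\ne S\subsetneq V}\frac{\sum_{\{x,y\}\in E,\;x\in S,\;y\notin S}w(x,y)}{\min\{|S|,|V\setminus S|\}}$$ be the edge expansion of $G$. Let $h_G(u,v)$ denote the hitting time from $u$ to $v$, i.e. the expected number of steps that the random walk on $G$ (moving from $x$ to a neighbour $y$ with probability $w(x,y)/\deg(x)$) started at $u$ needs to reach $v$; $h_{G'}(u,v)$ is defined in the same way from $w'$. Suppose that $\|L-L'\|_F\le\delta$ for some real $\delta$ with $0<\delta<\frac{\phi(G)^2}{2d_{\max}}$.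 Then for all $u,v\in V$ with $u\ne v$, the hitting times $h_G(u,v)$ and $h_{G'}(u,v)$ are finite and $$|h_G(u,v)-h_{G'}(u,v)|\le\frac{\delta}{d_{\min}}\,h_G(u,v)+12\,\delta\left(\frac{\phi(G)^2}{2d_{\max}}-\delta\right)^{-2}\sum_{e\in E}w_e .$$ -/

import Mathlib

open MeasureTheory ProbabilityTheory
open scoped ENNReal

/-- A finite simple undirected graph `(V, E, w)` with a positive real weight on every edge.
The weight function is extended by zero to all unordered pairs that are not edges. -/
structure WeightedGraph (V : Type*) extends SimpleGraph V where
  weight : Sym2 V → ℝ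
  weight_pos : ∀ e ∈ toSimpleGraph.edgeSet, 0 < weight e
  weight_eq_zero : ∀ e ∉ toSimpleGraph.edgeSet, weight e = 0

namespace WeightedGraph

noncomputable section

variable {V : Type*}

theorem weight_nonneg (G : WeightedGraph V) (e : Sym2 V) : 0 ≤ G.weight e := by
  by_cases h : e ∈ G.toSimpleGraph.edgeSet
  · exact (G.weight_pos e h).le
  · exact (G.weight_eq_zero e h).ge

variable [Fintype V]

/-- The weighted degree `deg(u) = ∑_{z ∈ N(u)} w(u, z)` (non-neighbours contribute zero). -/
def deg (G : WeightedGraph V) (u : V) : ℝ := ∑ z, G.weight s(u, z)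

/-- The minimum weighted degree. -/
def minDeg (G : WeightedGraph V) : ℝ := ⨅ u, G.deg u

/-- The maximum weighted degree. -/
def maxDeg (G : WeightedGraph V) : ℝ := ⨆ u, G.deg u

open Classical in
/-- The total edge weight `∑_{e ∈ E} w_e`. -/
def totalWeight (G : WeightedGraph V) : ℝ := ∑ e ∈ G.toSimpleGraph.edgeFinset, G.weight e

/-- The weighted adjacency matrix. -/
def adjMatrix (G : WeightedGraph V) : Matrix V V ℝ := Matrix.of fun u z => G.weight s(u, z)

/-- The graph Laplacian `L = D - A`. -/
def laplacian [DecidableEq V] (G : WeightedGraph V) : Matrix V V ℝ :=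
  Matrix.diagonal G.deg - G.adjMatrix

/-- The weight `e(S)` of the edges leaving `S`. -/
def cutWeight [DecidableEq V] (G : WeightedGraph V) (S : Finset V) : ℝ :=
  ∑ u ∈ S, ∑ z ∈ Sᶜ, G.weight s(u, z)

/-- The edge expansion `φ(G) = min_S e(S) / min {|S|, |V ∖ S|}`, where `S` ranges over the
nonempty proper subsets of the vertex set. -/
def edgeExpansion [DecidableEq V] (G : WeightedGraph V) : ℝ :=
  ⨅ S : {S : Finset V // S.Nonempty ∧ Sᶜ.Nonempty},
    G.cutWeight S.1 / (min S.1.card S.1ᶜ.card : ℕ)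

/-- One step of the random walk: from `u` move to `z` with probability `w(u, z) / deg(u)`.
(The walk stays put at an isolated vertex.) -/
def stepPMF (G : WeightedGraph V) (u : V) : PMF V :=
  if h : G.deg u = 0 then PMF.pure u
  else PMF.ofFintype (fun z => ENNReal.ofReal (G.weight s(u, z) / G.deg u)) (by
    have h0 : 0 ≤ G.deg u := Finset.sum_nonneg fun z _ => G.weight_nonneg _
    rw [← ENNReal.ofReal_sum_of_nonneg fun z _ => div_nonneg (G.weight_nonneg _) h0,
      ← Finset.sum_div]
    change ENNReal.ofReal (G.deg u / G.deg u) = 1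
    rw [div_self h, ENNReal.ofReal_one])

/-- The transition kernel of the random walk. -/
def stepKernel [MeasurableSpace V] [DiscreteMeasurableSpace V] (G : WeightedGraph V) :
    Kernel V V where
  toFun u := (G.stepPMF u).toMeasure
  measurable' := Measurable.of_discrete

instance [MeasurableSpace V] [DiscreteMeasurableSpace V] (G : WeightedGraph V) :
    IsMarkovKernel G.stepKernel :=
  ⟨fun u => inferInstanceAs (IsProbabilityMeasure (G.stepPMF u).toMeasure)⟩

/-- The transition kernel of the random walk as a function of the whole past `x 0, …, x n`:
it only looks at the current position `x n`. -/
def pastKernel [MeasurableSpace V] [DiscreteMeasurableSpace V] (G : WeightedGraph V) (n : ℕ) :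
    Kernel (Finset.Iic n → V) V :=
  G.stepKernel.comap (fun x => x ⟨n, Finset.mem_Iic.2 le_rfl⟩) (measurable_pi_apply _)

instance [MeasurableSpace V] [DiscreteMeasurableSpace V] (G : WeightedGraph V) (n : ℕ) :
    IsMarkovKernel (G.pastKernel n) :=
  inferInstanceAs (IsMarkovKernel (G.stepKernel.comap _ _))

/-- The law, on the space of trajectories `ℕ → V`, of the random walk started at `u`. -/
def walkMeasure [MeasurableSpace V] [DiscreteMeasurableSpace V] (G : WeightedGraph V) (u : V) :
    Measure (ℕ → V) :=
  Kernel.traj (X := fun _ => V) G.pastKernel 0 (fun _ => u)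

/-- The number of steps that a trajectory needs to reach `v` (`∞` if it never does). -/
def firstHit (v : V) (ω : ℕ → V) : ℝ≥0∞ := ⨅ (t : ℕ) (_ : ω t = v), (t : ℝ≥0∞)

/-- The hitting time from `u` to `v`: the expected number of steps that the random walk started
at `u` needs to reach `v`, as an element of `[0, ∞]`. -/
def hittingTime (G : WeightedGraph V) (u v : V) : ℝ≥0∞ :=
  letI : MeasurableSpace V := ⊤
  ∫⁻ ω, firstHit v ω ∂(G.walkMeasure u)

end

end WeightedGraph

/-- The Frobenius norm of a real matrix. -/
noncomputable def frobeniusNorm {V : Type*} [Fintype V] (M : Matrix V V ℝ) : ℝ :=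
  Real.sqrt (∑ i, ∑ j, M i j ^ 2)

/-! Write `lam` for $\phi(G)^2/(2d_{\max})$. Off `v`, with value 0 at `v`, the hitting times solve
`L x = deg` and `L' x' = deg'`. Insert the hybrid potential `p`, with `L p = deg'` off `v` and `p v
= 0`, and bound the two differences separately.

For `x - p` only the right-hand side changes, by at most `δ ≤ (δ / d_min) deg`, so the maximum
principle (`nonneg_of_laplacian_nonneg`) gives the relative error term.

For `p - x'` only the operator changes. Both images vanish in total, so `L p = L' x'` holds at `v`
too, and `L' (p - x') = -(L - L') p`. Cheeger's inequality (`hasSpectralGap_edgeExpansion`) gives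
`L` the gap `lam`, and the Frobenius bound leaves `L'` the gap `lam - δ > 0`. Inverting both
operators on mean-zero vectors costs at most `δ / (lam - δ) ^ 2` times the norm of `L p`, which is
controlled by the total degree (`potential_sub_le`). -/

/-! ### Hitting times and first-step equations. -/

namespace WeightedGraph

open Classical in
theorem firstHit_eq_tsum {V : Type*} (v : V) (ω : ℕ → V) :
    firstHit v ω = ∑' t : ℕ, if ∀ s ≤ t, ω s ≠ v then (1 : ℝ≥0∞) else 0 := by
  by_cases h : ∃ t, ω t = v
  · have hN := Nat.find_spec h
    have hlt : ∀ s, s < Nat.find h → ω s ≠ v := fun s hs => Nat.find_min h hs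
    rw [tsum_eq_sum (s := Finset.range (Nat.find h)), Finset.sum_congr rfl (g := fun _ => 1)]
    · simp only [Finset.sum_const, Finset.card_range, nsmul_eq_mul, mul_one]
      refine le_antisymm (iInf₂_le (Nat.find h) hN) (le_iInf₂ fun t ht => ?_)
      exact_mod_cast Nat.find_min' h ht
    · intro t ht
      rw [if_pos]
      exact fun s hs => hlt s (hs.trans_lt (Finset.mem_range.1 ht))
    · intro t ht
      rw [if_neg]
      exact fun h' => h' _ (not_lt.1 fun h1 => ht (Finset.mem_range.2 h1)) hN
  · push Not at h
    simp [firstHit, h]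

noncomputable section

variable {V : Type*} [Fintype V]

open Classical in
/-- One step of the walk killed at `v`, acting on functions. -/
def killedStep (G : WeightedGraph V) (v : V) (f : V → ℝ≥0∞) : V → ℝ≥0∞ :=
  fun y => ∑ z, G.stepPMF y z * if z = v then 0 else f z

theorem lintegral_stepKernel [MeasurableSpace V] [DiscreteMeasurableSpace V]
    (G : WeightedGraph V) (y : V) (f : V → ℝ≥0∞) :
    ∫⁻ z, f z ∂(G.stepKernel y) = ∑ z, G.stepPMF y z * f z := by
  rw [lintegral_fintype]
  refine Finset.sum_congr rfl fun z _ => ?_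
  rw [mul_comm]
  congr 1
  exact PMF.toMeasure_apply_singleton _ _ (measurableSet_singleton z)

open Classical in
theorem lintegral_survival_zero [MeasurableSpace V] [DiscreteMeasurableSpace V]
    (G : WeightedGraph V) (u v : V) (f : V → ℝ≥0∞) :
    ∫⁻ ω, (if ∀ s ≤ 0, ω s ≠ v then f (ω 0) else 0) ∂(G.walkMeasure u) =
      if u = v then 0 else f u := by
  have hm : Measurable fun x : Finset.Iic 0 → V =>
      if x ⟨0, Finset.mem_Iic.2 le_rfl⟩ = v then (0 : ℝ≥0∞)
        else f (x ⟨0, Finset.mem_Iic.2 le_rfl⟩) := Measurable.of_discrete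
  have h1 : ∀ ω : ℕ → V, (if ∀ s ≤ 0, ω s ≠ v then f (ω 0) else 0) =
      (fun x : Finset.Iic 0 → V => if x ⟨0, Finset.mem_Iic.2 le_rfl⟩ = v then (0 : ℝ≥0∞)
        else f (x ⟨0, Finset.mem_Iic.2 le_rfl⟩))
        (Preorder.frestrictLe (π := fun _ => V) 0 ω) := by
    intro ω
    by_cases h : ω 0 = v <;> simp [h]
  simp_rw [h1]
  rw [walkMeasure, ← lintegral_map hm (Preorder.measurable_frestrictLe 0),
    Kernel.traj_map_frestrictLe_apply, Kernel.partialTraj_self, Kernel.lintegral_id' hm]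

-- Markov property: given the path up to time `t`, the last coordinate is integrated out against the
-- step kernel.
open Classical in
theorem lintegral_survival_succ [MeasurableSpace V] [DiscreteMeasurableSpace V]
    (G : WeightedGraph V) (u v : V) (f : V → ℝ≥0∞) (t : ℕ) :
    ∫⁻ ω, (if ∀ s ≤ t + 1, ω s ≠ v then f (ω (t + 1)) else 0) ∂(G.walkMeasure u) =
      ∫⁻ ω, (if ∀ s ≤ t, ω s ≠ v then G.killedStep v f (ω t) else 0) ∂(G.walkMeasure u) := by
  let F : (Finset.Iic t → V) × V → ℝ≥0∞ := fun x =>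
    if ∀ i, x.1 i ≠ v then (if x.2 = v then 0 else f x.2) else 0
  have hF : Measurable F := Measurable.of_discrete
  let K : (Finset.Iic t → V) → ℝ≥0∞ := fun x =>
    if ∀ i, x i ≠ v then G.killedStep v f (x ⟨t, Finset.mem_Iic.2 le_rfl⟩) else 0
  have hK : Measurable K := Measurable.of_discrete
  have hall : ∀ ω : ℕ → V, (∀ i : Finset.Iic t, Preorder.frestrictLe (π := fun _ => V) t ω i ≠ v) ↔
      ∀ s ≤ t, ω s ≠ v := fun ω =>
    ⟨fun h s hs => h ⟨s, Finset.mem_Iic.2 hs⟩, fun h i => h i (Finset.mem_Iic.1 i.2)⟩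
  have h1 : ∀ ω : ℕ → V, (if ∀ s ≤ t + 1, ω s ≠ v then f (ω (t + 1)) else 0) =
      F (Preorder.frestrictLe (π := fun _ => V) t ω, ω (t + 1)) := by
    intro ω
    simp only [F, hall]
    by_cases h : ∀ s ≤ t, ω s ≠ v
    · by_cases h' : ω (t + 1) = v
      · rw [if_neg (fun h2 => h2 (t + 1) le_rfl h'), if_pos h, if_pos h']
      · rw [if_pos, if_pos h, if_neg h']
        intro s hs
        rcases Nat.le_succ_iff.1 hs with h3 | h3
        · exact h s h3
        · rwa [h3]
    · rw [if_neg (fun h2 => h fun s hs => h2 s (hs.trans t.le_succ)), if_neg h]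
  have h2 : ∀ ω : ℕ → V, (if ∀ s ≤ t, ω s ≠ v then G.killedStep v f (ω t) else 0) =
      K (Preorder.frestrictLe (π := fun _ => V) t ω) := by
    intro ω
    simp only [K, hall]
    rfl
  simp_rw [h1, h2]
  rw [walkMeasure, ← lintegral_map hK (Preorder.measurable_frestrictLe t),
    ← lintegral_map (g := fun ω : ℕ → V => (Preorder.frestrictLe (π := fun _ => V) t ω, ω (t + 1)))
      hF (by fun_prop),
    ← Kernel.partialTraj_compProd_eq_map_traj (Nat.zero_le t),
    Measure.lintegral_compProd hF, Kernel.traj_map_frestrictLe_apply]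
  refine lintegral_congr fun x => ?_
  change ∫⁻ z, F (x, z) ∂(G.stepKernel (x ⟨t, Finset.mem_Iic.2 le_rfl⟩)) = _
  rw [lintegral_stepKernel]
  by_cases h : ∀ i, x i ≠ v
  · simp only [F, K, if_pos h, killedStep]
  · simp only [F, K, if_neg h, mul_zero, Finset.sum_const_zero]

open Classical in
theorem lintegral_survival [MeasurableSpace V] [DiscreteMeasurableSpace V]
    (G : WeightedGraph V) (u v : V) (t : ℕ) (f : V → ℝ≥0∞) :
    ∫⁻ ω, (if ∀ s ≤ t, ω s ≠ v then f (ω t) else 0) ∂(G.walkMeasure u) =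
      if u = v then 0 else (G.killedStep v)^[t] f u := by
  induction t generalizing f with
  | zero =>
    convert G.lintegral_survival_zero u v f
    rfl
  | succ t ih => rw [lintegral_survival_succ, ih, Function.iterate_succ_apply]

-- Tail-sum formula for the expectation. The start `u = v` is separate because `killedStep` kills
-- only on arrival at `v`.
open Classical in
theorem hittingTime_eq_tsum (G : WeightedGraph V) (u v : V) :
    G.hittingTime u v = if u = v then 0 else ∑' t, (G.killedStep v)^[t] 1 u := by
  let _ : MeasurableSpace V := ⊤
  have _ : DiscreteMeasurableSpace V := ⟨fun _ => trivial⟩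
  change ∫⁻ ω, firstHit v ω ∂(G.walkMeasure u) = _
  simp_rw [firstHit_eq_tsum]
  rw [lintegral_tsum]
  · have := fun t => G.lintegral_survival u v t 1
    simp only [Pi.one_apply] at this
    simp_rw [this]
    split_ifs <;> simp
  · intro t
    refine (Measurable.ite ?_ measurable_const measurable_const).aemeasurable
    have : {ω : ℕ → V | ∀ s ≤ t, ω s ≠ v} = ⋂ s, ⋂ (_ : s ≤ t), (fun ω => ω s) ⁻¹' {v}ᶜ := by
      ext ω; simp
    rw [this]
    exact MeasurableSet.iInter fun s => MeasurableSet.iInter fun _ =>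
      measurable_pi_apply s (MeasurableSet.of_discrete)

theorem hittingTime_self (G : WeightedGraph V) (v : V) : G.hittingTime v v = 0 := by
  rw [hittingTime_eq_tsum, if_pos rfl]

theorem hittingTime_eq_one_add (G : WeightedGraph V) {u v : V} (h : u ≠ v) :
    G.hittingTime u v = 1 + ∑ z, G.stepPMF u z * G.hittingTime z v := by
  classical
  rw [hittingTime_eq_tsum, if_neg h, tsum_eq_zero_add' ENNReal.summable]
  congr 1
  simp_rw [Function.iterate_succ_apply', hittingTime_eq_tsum]
  rw [show (∑' t, G.killedStep v ((G.killedStep v)^[t] 1) u) =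
    ∑' t, ∑ z, G.stepPMF u z * if z = v then 0 else (G.killedStep v)^[t] 1 z from rfl,
    Summable.tsum_finsetSum fun _ _ => ENNReal.summable]
  refine Finset.sum_congr rfl fun z _ => ?_
  rw [ENNReal.tsum_mul_left]
  split_ifs <;> simp

/-- The hitting time is the smallest solution of the first-step equations. -/
theorem hittingTime_le (G : WeightedGraph V) {v : V} {h : V → ℝ≥0∞}
    (hh : ∀ u, u ≠ v → 1 + ∑ z, G.stepPMF u z * h z ≤ h u) (u : V) :
    G.hittingTime u v ≤ h u := by
  classical
  rw [hittingTime_eq_tsum]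
  split_ifs with huv
  · exact zero_le
  -- Bounding partial sums by induction uses only the supersolution inequality.
  rw [ENNReal.tsum_eq_iSup_nat]
  refine iSup_le fun n => ?_
  induction n generalizing u with
  | zero => simp
  | succ n ih =>
    refine le_trans ?_ (hh u huv)
    rw [Finset.sum_range_succ']
    simp_rw [Function.iterate_succ_apply']
    rw [add_comm]
    refine add_le_add le_rfl ?_
    change ∑ t ∈ Finset.range n, ∑ z, _ ≤ _
    rw [Finset.sum_comm]
    refine Finset.sum_le_sum fun z _ => ?_
    rw [← Finset.mul_sum]
    gcongr
    by_cases hz : z = v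
    · simp [hz]
    · simpa only [if_neg hz] using ih z hz

end

end WeightedGraph

/-! ### Frobenius norm bounds. -/

open Matrix

section FrobeniusNorm

variable {V : Type*} [Fintype V]

theorem dotProduct_self_nonneg' (x : V → ℝ) : 0 ≤ x ⬝ᵥ x :=
  Finset.sum_nonneg fun _ _ => mul_self_nonneg _

theorem sq_dotProduct_le (x y : V → ℝ) : (x ⬝ᵥ y) ^ 2 ≤ (x ⬝ᵥ x) * (y ⬝ᵥ y) := by
  simpa only [dotProduct, ← sq] using Finset.sum_mul_sq_le_sq_mul_sq Finset.univ x y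

theorem dotProduct_mulVec_self_le_of_frobeniusNorm_le {M : Matrix V V ℝ} {δ : ℝ}
    (hM : frobeniusNorm M ≤ δ) (x : V → ℝ) :
    (M *ᵥ x) ⬝ᵥ (M *ᵥ x) ≤ δ ^ 2 * (x ⬝ᵥ x) := by
  have h1 : ∑ i, ∑ j, M i j ^ 2 ≤ δ ^ 2 := Real.sqrt_le_iff.1 hM |>.2
  refine le_trans ?_ (mul_le_mul_of_nonneg_right h1 (dotProduct_self_nonneg' x))
  rw [Finset.sum_mul]
  refine Finset.sum_le_sum fun i _ => ?_
  rw [← sq]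
  refine (sq_dotProduct_le (M i) x).trans_eq ?_
  simp only [dotProduct, ← sq]

theorem abs_dotProduct_mulVec_le_of_frobeniusNorm_le {M : Matrix V V ℝ} {δ : ℝ}
    (hM : frobeniusNorm M ≤ δ) (x : V → ℝ) : |x ⬝ᵥ M *ᵥ x| ≤ δ * (x ⬝ᵥ x) := by
  have hδ : 0 ≤ δ := (Real.sqrt_nonneg _).trans hM
  have hx := dotProduct_self_nonneg' x
  refine abs_le_of_sq_le_sq ?_ (mul_nonneg hδ hx)
  calc (x ⬝ᵥ M *ᵥ x) ^ 2 ≤ (x ⬝ᵥ x) * ((M *ᵥ x) ⬝ᵥ (M *ᵥ x)) := sq_dotProduct_le _ _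
    _ ≤ (x ⬝ᵥ x) * (δ ^ 2 * (x ⬝ᵥ x)) :=
      mul_le_mul_of_nonneg_left (dotProduct_mulVec_self_le_of_frobeniusNorm_le hM x) hx
    _ = (δ * (x ⬝ᵥ x)) ^ 2 := by ring

theorem abs_apply_le_of_frobeniusNorm_le {M : Matrix V V ℝ} {δ : ℝ}
    (hM : frobeniusNorm M ≤ δ) (i j : V) : |M i j| ≤ δ := by
  refine le_trans ?_ hM
  refine Real.abs_le_sqrt ?_
  calc M i j ^ 2 ≤ ∑ j, M i j ^ 2 :=
        Finset.single_le_sum (f := fun j => M i j ^ 2) (fun _ _ => sq_nonneg _) (Finset.mem_univ j)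
    _ ≤ _ := Finset.single_le_sum (f := fun i => ∑ j, M i j ^ 2)
        (fun _ _ => Finset.sum_nonneg fun _ _ => sq_nonneg _) (Finset.mem_univ i)

end FrobeniusNorm

/-! ### Degrees and the Laplacian quadratic form. -/

namespace WeightedGraph

theorem weight_diag {V : Type*} (G : WeightedGraph V) (u : V) : G.weight s(u, u) = 0 :=
  G.weight_eq_zero _ (by simp)

variable {V : Type*} [Fintype V]

theorem deg_nonneg (G : WeightedGraph V) (u : V) : 0 ≤ G.deg u :=
  Finset.sum_nonneg fun _ _ => G.weight_nonneg _

theorem deg_le_maxDeg (G : WeightedGraph V) (u : V) : G.deg u ≤ G.maxDeg :=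
  le_ciSup (Set.finite_range G.deg).bddAbove u

theorem minDeg_le_deg (G : WeightedGraph V) (u : V) : G.minDeg ≤ G.deg u :=
  ciInf_le (Set.finite_range G.deg).bddBelow u

theorem maxDeg_nonneg (G : WeightedGraph V) : 0 ≤ G.maxDeg :=
  Real.iSup_nonneg G.deg_nonneg

theorem sum_weight_swap (G : WeightedGraph V) (f : V → V → ℝ) :
    ∑ i, ∑ j, G.weight s(i, j) * f i j = ∑ i, ∑ j, G.weight s(i, j) * f j i := by
  rw [Finset.sum_comm]
  simp only [Sym2.eq_swap]

variable [DecidableEq V]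

theorem laplacian_diag (G : WeightedGraph V) (u : V) : G.laplacian u u = G.deg u := by
  simp [laplacian, adjMatrix, weight_diag]

theorem laplacian_mulVec_apply (G : WeightedGraph V) (x : V → ℝ) (i : V) :
    (G.laplacian *ᵥ x) i = ∑ j, G.weight s(i, j) * (x i - x j) := by
  simp only [laplacian, sub_mulVec, Pi.sub_apply, mulVec_diagonal, mul_sub,
    Finset.sum_sub_distrib, ← Finset.sum_mul]
  rfl

theorem dotProduct_laplacian (G : WeightedGraph V) (x y : V → ℝ) :
    x ⬝ᵥ G.laplacian *ᵥ y =
      (∑ i, ∑ j, G.weight s(i, j) * ((x i - x j) * (y i - y j))) / 2 := by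
  have h1 : x ⬝ᵥ G.laplacian *ᵥ y = ∑ i, ∑ j, G.weight s(i, j) * (x i * (y i - y j)) := by
    simp only [dotProduct, laplacian_mulVec_apply, Finset.mul_sum]
    exact Finset.sum_congr rfl fun i _ => Finset.sum_congr rfl fun j _ => by ring
  have h2 := h1
  rw [sum_weight_swap] at h2
  rw [eq_div_iff two_ne_zero, mul_two]
  nth_rw 1 [h1]
  rw [h2, ← Finset.sum_add_distrib]
  refine Finset.sum_congr rfl fun i _ => ?_
  rw [← Finset.sum_add_distrib]
  exact Finset.sum_congr rfl fun j _ => by ring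

theorem dotProduct_laplacian_self_nonneg (G : WeightedGraph V) (x : V → ℝ) :
    0 ≤ x ⬝ᵥ G.laplacian *ᵥ x := by
  rw [dotProduct_laplacian]
  exact div_nonneg (Finset.sum_nonneg fun i _ => Finset.sum_nonneg fun j _ =>
    mul_nonneg (G.weight_nonneg _) (mul_self_nonneg _)) zero_le_two

theorem sum_laplacian_mulVec (G : WeightedGraph V) (x : V → ℝ) :
    ∑ i, (G.laplacian *ᵥ x) i = 0 := by
  have := G.dotProduct_laplacian 1 x
  simpa [dotProduct] using this

theorem laplacian_mulVec_sub_const (G : WeightedGraph V) (x : V → ℝ) (c : ℝ) :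
    (G.laplacian *ᵥ fun i => x i - c) = G.laplacian *ᵥ x := by
  ext i
  simp only [laplacian_mulVec_apply, sub_sub_sub_cancel_right]

/-! ### Edge expansion -/

theorem edgeExpansion_nonneg (G : WeightedGraph V) : 0 ≤ G.edgeExpansion :=
  Real.iInf_nonneg fun _ => div_nonneg
    (Finset.sum_nonneg fun _ _ => Finset.sum_nonneg fun _ _ => G.weight_nonneg _)
    (Nat.cast_nonneg _)

theorem edgeExpansion_mul_card_le_cutWeight (G : WeightedGraph V) {S : Finset V}
    (hS : S.Nonempty) (hcard : 2 * S.card ≤ Fintype.card V) :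
    G.edgeExpansion * S.card ≤ G.cutWeight S := by
  have hpos : 0 < S.card := hS.card_pos
  have hc : Sᶜ.card = Fintype.card V - S.card := Finset.card_compl S
  have hne : Sᶜ.Nonempty := Finset.card_pos.1 (by omega)
  have h := ciInf_le (f := fun S : {S : Finset V // S.Nonempty ∧ Sᶜ.Nonempty} =>
    G.cutWeight S.1 / (min S.1.card S.1ᶜ.card : ℕ)) (Set.finite_range _).bddBelow ⟨S, hS, hne⟩
  simp only at h
  rw [min_eq_left (by omega)] at h
  exact (le_div_iff₀ (Nat.cast_pos.2 hpos)).1 h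

theorem edgeExpansion_le_deg (G : WeightedGraph V) [Nontrivial V] (u : V) :
    G.edgeExpansion ≤ G.deg u := by
  have h := G.edgeExpansion_mul_card_le_cutWeight (Finset.singleton_nonempty u)
    (by simpa [Nat.succ_le_iff] using Fintype.one_lt_card (α := V))
  simp only [Finset.card_singleton, Nat.cast_one, mul_one, cutWeight, Finset.sum_singleton] at h
  exact h.trans (Finset.sum_le_sum_of_subset_of_nonneg (Finset.subset_univ _)
    fun _ _ _ => G.weight_nonneg _)

/-- The factor 2 appears because ordered pairs see each cut edge twice. -/
theorem sum_weight_abs_indicator_sub (G : WeightedGraph V) (S : Finset V) :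
    ∑ i, ∑ j, G.weight s(i, j) * |(if i ∈ S then (1 : ℝ) else 0) - if j ∈ S then 1 else 0| =
      2 * G.cutWeight S := by
  have h : ∀ i j, G.weight s(i, j) * |(if i ∈ S then (1 : ℝ) else 0) - if j ∈ S then 1 else 0| =
      G.weight s(i, j) * (if i ∈ S then if j ∈ Sᶜ then 1 else 0 else 0) +
      G.weight s(i, j) * (if j ∈ S then if i ∈ Sᶜ then 1 else 0 else 0) := by
    intro i j
    by_cases hi : i ∈ S <;> by_cases hj : j ∈ S <;> simp [hi, hj]
  simp only [h, Finset.sum_add_distrib]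
  rw [← G.sum_weight_swap fun i j => if i ∈ S then if j ∈ Sᶜ then 1 else 0 else 0, ← two_mul]
  congr 1
  calc _ = ∑ i, if i ∈ S then ∑ z ∈ Sᶜ, G.weight s(i, z) else 0 := by
        refine Finset.sum_congr rfl fun i _ => ?_
        split_ifs with hi
        · simp only [mul_ite, mul_one, mul_zero, Finset.sum_ite_mem, Finset.univ_inter]
        · simp
    _ = G.cutWeight S := by rw [Finset.sum_ite_mem, Finset.univ_inter, cutWeight]

end WeightedGraph

/-- A finite family of reals has a median. -/
theorem exists_median {V : Type*} [Fintype V] [Nonempty V] (x : V → ℝ) :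
    ∃ m : ℝ, 2 * (Finset.univ.filter fun i => m < x i).card ≤ Fintype.card V ∧
      2 * (Finset.univ.filter fun i => x i < m).card ≤ Fintype.card V := by
  classical
  -- The median is the least value with at most half of the entries above it. If more than half lay
  -- below, the next smaller value would have more than half above it: two disjoint majorities.
  let T : Finset V := Finset.univ.filter fun k =>
    2 * (Finset.univ.filter fun i => x k < x i).card ≤ Fintype.card V
  have hT : T.Nonempty := by
    obtain ⟨k, hk⟩ := Finite.exists_max x
    refine ⟨k, Finset.mem_filter.2 ⟨Finset.mem_univ _, ?_⟩⟩
    rw [Finset.filter_false_of_mem fun i _ => not_lt.2 (hk i)]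
    simp
  obtain ⟨k, hkT, hk⟩ := T.exists_min_image x hT
  refine ⟨x k, (Finset.mem_filter.1 hkT).2, ?_⟩
  by_contra! hlt
  have hne : (Finset.univ.filter fun i => x i < x k).Nonempty := by
    rw [← Finset.card_pos]; omega
  obtain ⟨l, hl, hmax⟩ := Finset.exists_max_image _ x hne
  have hlk : x l < x k := (Finset.mem_filter.1 hl).2
  have hlT : ¬ 2 * (Finset.univ.filter fun i => x l < x i).card ≤ Fintype.card V :=
    fun h => absurd (hk l (Finset.mem_filter.2 ⟨Finset.mem_univ _, h⟩)) (not_le.2 hlk)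
  have hdisj : Disjoint (Finset.univ.filter fun i => x i < x k)
      (Finset.univ.filter fun i => x l < x i) := by
    rw [Finset.disjoint_left]
    intro i hi hi'
    exact absurd (hmax i hi) (not_le.2 (Finset.mem_filter.1 hi').2)
  have := (Finset.card_union_of_disjoint hdisj).symm.trans_le (Finset.card_le_univ _)
  omega

/-! ### Coarea and Cheeger inequalities. -/

namespace WeightedGraph

variable {V : Type*} [Fintype V]

theorem sum_weight_mul_sq_add_sq (G : WeightedGraph V) (z : V → ℝ) :
    ∑ i, ∑ j, G.weight s(i, j) * (z i ^ 2 + z j ^ 2) = 2 * ∑ i, G.deg i * z i ^ 2 := by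
  simp only [mul_add, Finset.sum_add_distrib]
  rw [← G.sum_weight_swap fun i _ => z i ^ 2, ← two_mul]
  simp only [deg, Finset.sum_mul]

variable [DecidableEq V]

/-- Coarea inequality: the total variation of a nonnegative function supported on at most half of
the vertices is bounded below by the edge expansion. -/
theorem edgeExpansion_mul_sum_le (G : WeightedGraph V) (g : V → ℝ) (hg : ∀ i, 0 ≤ g i)
    (hsupp : 2 * (Finset.univ.filter fun i => 0 < g i).card ≤ Fintype.card V) :
    2 * G.edgeExpansion * ∑ i, g i ≤ ∑ i, ∑ j, G.weight s(i, j) * |g i - g j| := by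
  induction hn : (Finset.univ.filter fun i => 0 < g i).card using Nat.strong_induction_on
    generalizing g with
  | _ n ih =>
  set S := Finset.univ.filter fun i => 0 < g i with hS
  have hnot : ∀ i, i ∉ S → g i = 0 := fun i hi =>
    le_antisymm (not_lt.1 fun h => hi (Finset.mem_filter.2 ⟨Finset.mem_univ _, h⟩)) (hg i)
  rcases S.eq_empty_or_nonempty with h0 | hne
  · have : ∀ i, g i = 0 := fun i => hnot i (by simp [h0])
    simp [this]
  obtain ⟨k, hk, hmin⟩ := S.exists_min_image g hne
  have hkpos : 0 < g k := (Finset.mem_filter.1 hk).2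
  -- Peel off the bottom layer, of height `g k`, over the support. The support shrinks, and the
  -- total variation splits additively.
  let I : V → ℝ := fun i => if i ∈ S then 1 else 0
  let g' : V → ℝ := fun i => g i - g k * I i
  have hg' : ∀ i, 0 ≤ g' i := by
    intro i
    by_cases hi : i ∈ S
    · simpa [g', I, hi] using hmin i hi
    · simpa [g', I, hi] using hg i
  have hss : (Finset.univ.filter fun i => 0 < g' i) ⊂ S := by
    refine Finset.ssubset_iff_of_subset (fun i hi => ?_) |>.2 ⟨k, hk, ?_⟩
    · by_contra hiS
      have := (Finset.mem_filter.1 hi).2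
      simp [g', I, hiS, hnot i hiS] at this
    · simp [g', I, hk]
  have hcard := Finset.card_lt_card hss
  have hrec := ih _ (hn ▸ hcard) g' hg' (by omega) rfl
  have hsum : ∑ i, g i = ∑ i, g' i + g k * S.card := by
    simp [g', I, Finset.sum_sub_distrib, mul_comm]
  have habs : ∀ i j, |g i - g j| = |g' i - g' j| + g k * |I i - I j| := by
    intro i j
    by_cases hi : i ∈ S <;> by_cases hj : j ∈ S
    · simp [g', I, hi, hj]
    · have h1 := hmin i hi
      simp only [g', I, hi, hj, hnot j hj, if_true, if_false]
      rw [abs_of_nonneg (by linarith), abs_of_nonneg (by linarith), abs_of_nonneg (by norm_num)]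
      ring
    · have h1 := hmin j hj
      simp only [g', I, hi, hj, hnot i hi, if_true, if_false]
      rw [abs_of_nonpos (by linarith), abs_of_nonpos (by linarith), abs_of_nonpos (by norm_num)]
      ring
    · simp [g', I, hi, hj]
  have htot : ∑ i, ∑ j, G.weight s(i, j) * |g i - g j| =
      ∑ i, ∑ j, G.weight s(i, j) * |g' i - g' j| + g k * (2 * G.cutWeight S) := by
    rw [← G.sum_weight_abs_indicator_sub S, Finset.mul_sum, ← Finset.sum_add_distrib]
    refine Finset.sum_congr rfl fun i _ => ?_
    rw [Finset.mul_sum, ← Finset.sum_add_distrib]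
    refine Finset.sum_congr rfl fun j _ => ?_
    rw [habs]
    ring
  have hcut := mul_le_mul_of_nonneg_left (G.edgeExpansion_mul_card_le_cutWeight hne hsupp) hkpos.le
  rw [hsum, htot]
  linarith

/-- Cheeger's inequality for a nonnegative function supported on at most half of the vertices. -/
theorem edgeExpansion_sq_mul_le (G : WeightedGraph V) (z : V → ℝ) (hz : ∀ i, 0 ≤ z i)
    (hsupp : 2 * (Finset.univ.filter fun i => 0 < z i).card ≤ Fintype.card V) :
    G.edgeExpansion ^ 2 * (z ⬝ᵥ z) ≤ 2 * G.maxDeg * (z ⬝ᵥ G.laplacian *ᵥ z) := by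
  set Q := z ⬝ᵥ z with hQ
  set E := z ⬝ᵥ G.laplacian *ᵥ z with hE
  have hE0 : 0 ≤ E := G.dotProduct_laplacian_self_nonneg z
  have hQ0 : 0 ≤ Q := dotProduct_self_nonneg' z
  have hQ2 : Q = ∑ i, z i ^ 2 := by simp only [hQ, dotProduct, ← sq]
  have hco := G.edgeExpansion_mul_sum_le (fun i => z i ^ 2) (fun i => sq_nonneg _) (by
    refine le_of_eq_of_le ?_ hsupp
    congr 3
    ext i
    exact ⟨fun h => (hz i).lt_of_ne fun h0 => by simp [← h0] at h, fun h => pow_pos h 2⟩)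
  have hA : ∑ p : V × V, G.weight s(p.1, p.2) * (z p.1 - z p.2) ^ 2 = 2 * E := by
    rw [Fintype.sum_prod_type, hE, dotProduct_laplacian]
    simp only [← sq]
    ring
  have hB : ∑ p : V × V, G.weight s(p.1, p.2) * (z p.1 + z p.2) ^ 2 ≤ 4 * G.maxDeg * Q := by
    calc _ ≤ ∑ p : V × V, 2 * (G.weight s(p.1, p.2) * (z p.1 ^ 2 + z p.2 ^ 2)) := by
          refine Finset.sum_le_sum fun p _ => ?_
          have := mul_le_mul_of_nonneg_left (add_sq_le (a := z p.1) (b := z p.2))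
            (G.weight_nonneg s(p.1, p.2))
          linarith
      _ = 4 * ∑ i, G.deg i * z i ^ 2 := by
          rw [← Finset.mul_sum, Fintype.sum_prod_type, G.sum_weight_mul_sq_add_sq]
          ring
      _ ≤ 4 * (G.maxDeg * Q) := by
          rw [hQ2, Finset.mul_sum _ _ G.maxDeg]
          refine mul_le_mul_of_nonneg_left (Finset.sum_le_sum fun i _ => ?_) (zero_le_four (α := ℝ))
          exact mul_le_mul_of_nonneg_right (G.deg_le_maxDeg i) (sq_nonneg _)
      _ = _ := by ring
  -- Cauchy–Schwarz on `|z i ^ 2 - z j ^ 2| = |z i - z j| * |z i + z j|`, the left side being the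
  -- variation in the coarea bound for `z ^ 2`.
  have hCS := Finset.sum_sq_le_sum_mul_sum_of_sq_le_mul (Finset.univ : Finset (V × V))
    (r := fun p => G.weight s(p.1, p.2) * |z p.1 ^ 2 - z p.2 ^ 2|)
    (f := fun p => G.weight s(p.1, p.2) * (z p.1 - z p.2) ^ 2)
    (g := fun p => G.weight s(p.1, p.2) * (z p.1 + z p.2) ^ 2)
    (fun p _ => mul_nonneg (G.weight_nonneg _) (sq_nonneg _))
    (fun p _ => mul_nonneg (G.weight_nonneg _) (sq_nonneg _))
    (fun p _ => by rw [mul_pow, sq_abs]; exact le_of_eq (by ring))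
  rw [Fintype.sum_prod_type, hA] at hCS
  rw [← hQ2] at hco
  have h1 : (2 * G.edgeExpansion * Q) ^ 2 ≤ 2 * E * (4 * G.maxDeg * Q) :=
    (pow_le_pow_left₀ (mul_nonneg (mul_nonneg zero_le_two G.edgeExpansion_nonneg) hQ0) hco 2).trans
      (hCS.trans (mul_le_mul_of_nonneg_left hB (by linarith)))
  rcases hQ0.eq_or_lt with h0 | hpos
  · rw [← h0, mul_zero]
    exact mul_nonneg (mul_nonneg zero_le_two G.maxDeg_nonneg) hE0
  · refine le_of_mul_le_mul_right ?_ (mul_pos four_pos hpos)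
    nlinarith [h1]

/-- `μ` is a lower bound for the second smallest eigenvalue of the Laplacian. -/
def HasSpectralGap (G : WeightedGraph V) (μ : ℝ) : Prop :=
  ∀ x : V → ℝ, ∑ i, x i = 0 → μ * (x ⬝ᵥ x) ≤ x ⬝ᵥ G.laplacian *ᵥ x

/-- **Cheeger's inequality**: the second smallest eigenvalue of the Laplacian is at least
`φ(G) ^ 2 / (2 * d_max)`. -/
theorem hasSpectralGap_edgeExpansion (G : WeightedGraph V) [Nonempty V] :
    G.HasSpectralGap (G.edgeExpansion ^ 2 / (2 * G.maxDeg)) := by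
  intro x hx
  rcases G.maxDeg_nonneg.eq_or_lt with h0 | hpos
  -- Here the claimed gap is a division by zero, hence 0.
  · simpa [← h0] using G.dotProduct_laplacian_self_nonneg x
  -- The positive and negative parts of `x - m` each live on at most half of the vertices. Since `x`
  -- has mean zero, shifting by `m` cannot decrease its norm; splitting cannot increase the energy.
  obtain ⟨m, hm1, hm2⟩ := exists_median x
  have h1 := G.edgeExpansion_sq_mul_le (fun i => max (x i - m) 0) (fun i => le_max_right _ _)
    (by simpa using hm1)
  have h2 := G.edgeExpansion_sq_mul_le (fun i => max (m - x i) 0) (fun i => le_max_right _ _)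
    (by simpa using hm2)
  have hnorm : x ⬝ᵥ x ≤ (fun i => max (x i - m) 0) ⬝ᵥ (fun i => max (x i - m) 0) +
      (fun i => max (m - x i) 0) ⬝ᵥ (fun i => max (m - x i) 0) := by
    have h3 : ∀ i, max (x i - m) 0 * max (x i - m) 0 + max (m - x i) 0 * max (m - x i) 0 =
        x i * x i - 2 * m * x i + m * m := by
      intro i
      rcases le_total (x i) m with h | h
      · rw [max_eq_right (by linarith), max_eq_left (by linarith)]; ring
      · rw [max_eq_left (by linarith), max_eq_right (by linarith)]; ring
    simp only [dotProduct]
    rw [← Finset.sum_add_distrib, Finset.sum_congr rfl fun i _ => h3 i, Finset.sum_add_distrib,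
      Finset.sum_sub_distrib, ← Finset.mul_sum, hx]
    have : 0 ≤ ∑ _i : V, m * m := Finset.sum_nonneg fun _ _ => mul_self_nonneg m
    linarith
  have henergy : (fun i => max (x i - m) 0) ⬝ᵥ G.laplacian *ᵥ (fun i => max (x i - m) 0) +
      (fun i => max (m - x i) 0) ⬝ᵥ G.laplacian *ᵥ (fun i => max (m - x i) 0) ≤
        x ⬝ᵥ G.laplacian *ᵥ x := by
    simp only [dotProduct_laplacian]
    rw [← add_div, ← Finset.sum_add_distrib]
    refine div_le_div_of_nonneg_right (Finset.sum_le_sum fun i _ => ?_) zero_le_two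
    rw [← Finset.sum_add_distrib]
    refine Finset.sum_le_sum fun j _ => ?_
    rw [← mul_add]
    refine mul_le_mul_of_nonneg_left ?_ (G.weight_nonneg _)
    rcases le_total (x i) m with h | h <;> rcases le_total (x j) m with h' | h'
    · rw [max_eq_right (by linarith : x i - m ≤ 0), max_eq_right (by linarith : x j - m ≤ 0),
        max_eq_left (by linarith : 0 ≤ m - x i), max_eq_left (by linarith : 0 ≤ m - x j)]
      nlinarith
    · rw [max_eq_right (by linarith : x i - m ≤ 0), max_eq_left (by linarith : 0 ≤ x j - m),
        max_eq_left (by linarith : 0 ≤ m - x i), max_eq_right (by linarith : m - x j ≤ 0)]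
      nlinarith
    · rw [max_eq_left (by linarith : 0 ≤ x i - m), max_eq_right (by linarith : x j - m ≤ 0),
        max_eq_right (by linarith : m - x i ≤ 0), max_eq_left (by linarith : 0 ≤ m - x j)]
      nlinarith
    · rw [max_eq_left (by linarith : 0 ≤ x i - m), max_eq_left (by linarith : 0 ≤ x j - m),
        max_eq_right (by linarith : m - x i ≤ 0), max_eq_right (by linarith : m - x j ≤ 0)]
      nlinarith
  have h4 : 0 < 2 * G.maxDeg := by linarith
  rw [div_mul_eq_mul_div, div_le_iff₀ h4]
  have h5 := mul_le_mul_of_nonneg_left hnorm (sq_nonneg G.edgeExpansion)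
  have h6 := mul_le_mul_of_nonneg_left henergy h4.le
  linarith

end WeightedGraph

/-! ### Spectral gap, the Dirichlet problem and hitting times. -/

namespace WeightedGraph

variable {V : Type*} [Fintype V]

theorem sum_deg (G : WeightedGraph V) : ∑ u, G.deg u = 2 * G.totalWeight := by
  classical
  have h1 : ∑ u, G.deg u = ∑ d : G.toSimpleGraph.Dart, G.weight d.edge := by
    simp only [deg]
    rw [← Fintype.sum_prod_type']
    refine (Finset.sum_of_injOn (fun d : G.toSimpleGraph.Dart => d.toProd)
      (fun d _ d' _ h => SimpleGraph.Dart.ext _ _ h) (fun _ _ => Finset.mem_coe.2 (Finset.mem_univ _))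
      (fun p _ hp => G.weight_eq_zero _ fun h => hp ?_) (fun d _ => rfl)).symm
    exact ⟨⟨p, h⟩, by simp, rfl⟩
  rw [h1, totalWeight, Finset.mul_sum,
    ← Finset.sum_fiberwise_of_maps_to (s := Finset.univ) (t := G.toSimpleGraph.edgeFinset)
      (g := fun d : G.toSimpleGraph.Dart => d.edge)
      fun d _ => SimpleGraph.mem_edgeFinset.2 d.edge_mem]
  refine Finset.sum_congr rfl fun e he => ?_
  rw [Finset.sum_congr rfl fun d hd => congrArg G.weight (Finset.mem_filter.1 hd).2,
    Finset.sum_const, nsmul_eq_mul]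
  congr 1
  exact_mod_cast G.toSimpleGraph.dart_edge_fiber_card e (SimpleGraph.mem_edgeFinset.1 he)

theorem stepPMF_apply (G : WeightedGraph V) {u : V} (hu : G.deg u ≠ 0) (z : V) :
    G.stepPMF u z = ENNReal.ofReal (G.weight s(u, z) / G.deg u) := by
  rw [stepPMF, dif_neg hu]
  rfl

variable [DecidableEq V]

theorem laplacian_mulVec_eq_deg_mul (G : WeightedGraph V) (x : V → ℝ) (i : V)
    (hi : G.deg i ≠ 0) :
    (G.laplacian *ᵥ x) i = G.deg i * (x i - ∑ j, G.weight s(i, j) / G.deg i * x j) := by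
  rw [laplacian_mulVec_apply, mul_sub, Finset.mul_sum]
  simp only [mul_sub, Finset.sum_sub_distrib, ← Finset.sum_mul]
  congr 1
  exact Finset.sum_congr rfl fun j _ => by field_simp

namespace HasSpectralGap

variable {G : WeightedGraph V} {μ : ℝ}

/-- Removing the mean preserves the energy, and a positive gap then forces the centred vector to
vanish. -/
theorem eq_of_dotProduct_nonpos (h : G.HasSpectralGap μ) (hμ : 0 < μ) {x : V → ℝ}
    (hx : x ⬝ᵥ G.laplacian *ᵥ x ≤ 0) (i j : V) : x i = x j := by
  have : Nonempty V := ⟨i⟩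
  set c : ℝ := (∑ k, x k) / Fintype.card V with hc
  have hcard : (Fintype.card V : ℝ) ≠ 0 := Nat.cast_ne_zero.2 Fintype.card_ne_zero
  have hsum : ∑ k, (x k - c) = 0 := by
    rw [Finset.sum_sub_distrib, Finset.sum_const, Finset.card_univ, nsmul_eq_mul, hc,
      mul_div_cancel₀ _ hcard, sub_self]
  have h1 := h _ hsum
  have h2 : (fun k => x k - c) ⬝ᵥ (G.laplacian *ᵥ fun k => x k - c) = x ⬝ᵥ G.laplacian *ᵥ x := by
    simp only [dotProduct_laplacian, sub_sub_sub_cancel_right]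
  rw [h2] at h1
  have h3 : (fun k => x k - c) ⬝ᵥ (fun k => x k - c) = 0 :=
    le_antisymm (nonpos_of_mul_nonpos_right (h1.trans hx) hμ) (dotProduct_self_nonneg' _)
  have h4 := congrFun (dotProduct_self_eq_zero.1 h3)
  have h5 := h4 i
  have h6 := h4 j
  simp only [Pi.zero_apply] at h5 h6
  linarith

/-- Maximum principle. -/
theorem nonneg_of_laplacian_nonneg (h : G.HasSpectralGap μ) (hμ : 0 < μ) {v : V} {x : V → ℝ}
    (hv : 0 ≤ x v) (hx : ∀ i, i ≠ v → 0 ≤ (G.laplacian *ᵥ x) i) (i : V) : 0 ≤ x i := by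
  -- Testing against the negative part `n` shows that `n` has no energy, so it is constant, equal to
  -- `n v = 0`.
  set n : V → ℝ := fun i => max (-x i) 0 with hn
  have hnv : n v = 0 := max_eq_right (by linarith)
  have h1 : 0 ≤ n ⬝ᵥ G.laplacian *ᵥ x := by
    refine Finset.sum_nonneg fun i _ => ?_
    by_cases hi : i = v
    · rw [hi, hnv, zero_mul]
    · exact mul_nonneg (le_max_right _ _) (hx i hi)
  have h2 : n ⬝ᵥ G.laplacian *ᵥ n ≤ -(n ⬝ᵥ G.laplacian *ᵥ x) := by
    rw [dotProduct_laplacian, dotProduct_laplacian, ← neg_div]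
    refine div_le_div_of_nonneg_right ?_ zero_le_two
    rw [← Finset.sum_neg_distrib]
    refine Finset.sum_le_sum fun i _ => ?_
    rw [← Finset.sum_neg_distrib]
    refine Finset.sum_le_sum fun j _ => ?_
    rw [← mul_neg]
    refine mul_le_mul_of_nonneg_left ?_ (G.weight_nonneg _)
    simp only [hn]
    rcases max_cases (-x i) 0 with ⟨h, h'⟩ | ⟨h, h'⟩ <;>
      rcases max_cases (-x j) 0 with ⟨k, k'⟩ | ⟨k, k'⟩ <;> rw [h, k] <;> nlinarith
  have h3 := h.eq_of_dotProduct_nonpos hμ (h2.trans (neg_nonpos.2 h1)) i v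
  rw [hnv] at h3
  linarith [(max_eq_right_iff.1 h3 : -x i ≤ 0)]

/-- The Dirichlet problem with one boundary vertex is solvable. -/
theorem exists_laplacian_eq (h : G.HasSpectralGap μ) (hμ : 0 < μ) (v : V) (c : V → ℝ) :
    ∃ x : V → ℝ, x v = 0 ∧ ∀ i, i ≠ v → (G.laplacian *ᵥ x) i = c i := by
  -- Row `v` of the Laplacian is replaced by evaluation at `v`. The maximum principle makes this
  -- square system injective, hence surjective.
  let T : (V → ℝ) →ₗ[ℝ] (V → ℝ) := LinearMap.pi fun i =>
    if i = v then LinearMap.proj v else LinearMap.proj i ∘ₗ G.laplacian.mulVecLin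
  have hT : ∀ x i, T x i = if i = v then x v else (G.laplacian *ᵥ x) i := by
    intro x i
    simp only [T, LinearMap.pi_apply]
    split_ifs <;> rfl
  have hinj : Function.Injective T := by
    rw [← LinearMap.ker_eq_bot, LinearMap.ker_eq_bot']
    intro x hx
    have hxv : x v = 0 := by simpa [hT] using congrFun hx v
    have hLx : ∀ i, i ≠ v → (G.laplacian *ᵥ x) i = 0 := fun i hi => by
      simpa [hT, hi] using congrFun hx i
    ext i
    refine le_antisymm ?_ (h.nonneg_of_laplacian_nonneg hμ hxv.ge (fun i hi => (hLx i hi).ge) i)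
    have := h.nonneg_of_laplacian_nonneg hμ (v := v) (x := -x) (by simp [hxv])
      (fun i hi => by simp [mulVec_neg, hLx i hi]) i
    simpa using this
  obtain ⟨x, hx⟩ := LinearMap.injective_iff_surjective.1 hinj (fun i => if i = v then 0 else c i)
  refine ⟨x, by simpa [hT] using congrFun hx v, fun i hi => ?_⟩
  simpa [hT, hi] using congrFun hx i

/-- Cauchy–Schwarz turns the quadratic-form gap into a bound on the inverse over mean-zero vectors.
-/
theorem sq_mul_le (h : G.HasSpectralGap μ) (hμ : 0 ≤ μ) {x : V → ℝ} (hx : ∑ i, x i = 0) :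
    μ ^ 2 * (x ⬝ᵥ x) ≤ (G.laplacian *ᵥ x) ⬝ᵥ (G.laplacian *ᵥ x) := by
  have h0 := dotProduct_self_nonneg' x
  rcases h0.eq_or_lt with h0' | hpos
  · rw [← h0', mul_zero]
    exact dotProduct_self_nonneg' _
  · refine le_of_mul_le_mul_left ?_ hpos
    calc (x ⬝ᵥ x) * (μ ^ 2 * (x ⬝ᵥ x)) = (μ * (x ⬝ᵥ x)) ^ 2 := by ring
      _ ≤ (x ⬝ᵥ G.laplacian *ᵥ x) ^ 2 := pow_le_pow_left₀ (mul_nonneg hμ h0) (h x hx) 2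
      _ ≤ _ := sq_dotProduct_le _ _

/-- Stability of the spectral gap under perturbation of the Laplacian. -/
theorem sub (h : G.HasSpectralGap μ) {G' : WeightedGraph V} {δ : ℝ}
    (hL : frobeniusNorm (G.laplacian - G'.laplacian) ≤ δ) : G'.HasSpectralGap (μ - δ) := by
  intro x hx
  have h1 := h x hx
  have h2 := (abs_le.1 (abs_dotProduct_mulVec_le_of_frobeniusNorm_le hL x)).2
  rw [sub_mulVec, dotProduct_sub] at h2
  linarith

/-- The hitting times are finite, and they solve the Dirichlet problem `L h = deg` off `v`. -/
theorem hittingTime_toReal (h : G.HasSpectralGap μ) (hμ : 0 < μ) (hdeg : ∀ i, 0 < G.deg i)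
    (v : V) : (∀ u, G.hittingTime u v ≠ ∞) ∧
      ∀ u, u ≠ v → (G.laplacian *ᵥ fun i => (G.hittingTime i v).toReal) u = G.deg u := by
  have hne : ∀ i, G.deg i ≠ 0 := fun i => (hdeg i).ne'
  have hw : ∀ i j, 0 ≤ G.weight s(i, j) / G.deg i := fun i j =>
    div_nonneg (G.weight_nonneg _) (hdeg i).le
  -- The real Dirichlet solution satisfies the first-step equations, so minimality of the hitting
  -- time makes the latter finite.
  obtain ⟨x, hxv, hx⟩ := h.exists_laplacian_eq hμ v G.deg
  have hx0 := h.nonneg_of_laplacian_nonneg hμ hxv.ge fun i hi => (hx i hi).symm ▸ (hdeg i).le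
  have hfin : ∀ u, G.hittingTime u v ≠ ∞ := by
    intro u
    refine ne_top_of_le_ne_top ENNReal.ofReal_ne_top
      (G.hittingTime_le (h := fun i => ENNReal.ofReal (x i)) (fun i hi => le_of_eq ?_) u)
    have h1 : x i = 1 + ∑ j, G.weight s(i, j) / G.deg i * x j := by
      have h2 := hx i hi
      rw [G.laplacian_mulVec_eq_deg_mul x i (hne i)] at h2
      have h3 := mul_left_cancel₀ (hne i) (h2.trans (mul_one _).symm)
      linarith
    rw [h1, ENNReal.ofReal_add zero_le_one
      (Finset.sum_nonneg fun j _ => mul_nonneg (hw i j) (hx0 j)), ENNReal.ofReal_one,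
      ENNReal.ofReal_sum_of_nonneg fun j _ => mul_nonneg (hw i j) (hx0 j)]
    congr 1
    refine Finset.sum_congr rfl fun j _ => ?_
    rw [G.stepPMF_apply (hne i), ENNReal.ofReal_mul (hw i j)]
  refine ⟨hfin, fun u hu => ?_⟩
  have h1 : (G.hittingTime u v).toReal =
      1 + ∑ j, G.weight s(u, j) / G.deg u * (G.hittingTime j v).toReal := by
    have hterm : ∀ j ∈ Finset.univ, G.stepPMF u j * G.hittingTime j v ≠ ∞ := fun j _ =>
      ENNReal.mul_ne_top (PMF.apply_ne_top _ _) (hfin j)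
    rw [G.hittingTime_eq_one_add hu, ENNReal.toReal_add ENNReal.one_ne_top
      (ENNReal.sum_ne_top.2 hterm), ENNReal.toReal_one, ENNReal.toReal_sum hterm]
    congr 1
    refine Finset.sum_congr rfl fun j _ => ?_
    rw [ENNReal.toReal_mul, G.stepPMF_apply (hne u), ENNReal.toReal_ofReal (hw u j)]
  rw [G.laplacian_mulVec_eq_deg_mul _ u (hne u)]
  rw [h1, add_sub_cancel_right, mul_one]

end HasSpectralGap

/-! ### Comparison of potentials. -/

/-- If `L x = c` off `v` with `c ≥ 0`, then `‖L x‖² ≤ 2 (∑ c)²`. -/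
theorem laplacian_mulVec_dotProduct_self_le (G : WeightedGraph V) {v : V} {x c : V → ℝ}
    (hc : ∀ i, 0 ≤ c i) (hx : ∀ i, i ≠ v → (G.laplacian *ᵥ x) i = c i) :
    (G.laplacian *ᵥ x) ⬝ᵥ (G.laplacian *ᵥ x) ≤ 2 * (∑ i, c i) ^ 2 := by
  set f := G.laplacian *ᵥ x with hf
  set t := ∑ i ∈ Finset.univ.erase v, c i with ht
  have ht0 : 0 ≤ t := Finset.sum_nonneg fun i _ => hc i
  have htot : t ≤ ∑ i, c i :=
    Finset.sum_le_sum_of_subset_of_nonneg (Finset.subset_univ _) fun i _ _ => hc i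
  have hfe : ∀ i ∈ Finset.univ.erase v, f i = c i := fun i hi => hx i (Finset.ne_of_mem_erase hi)
  -- The entries of `L x` sum to zero, which determines the one at `v`.
  have hfv : f v = -t := by
    have h1 := G.sum_laplacian_mulVec x
    rw [← hf, ← Finset.add_sum_erase _ _ (Finset.mem_univ v), Finset.sum_congr rfl hfe] at h1
    linarith
  have h2 : f ⬝ᵥ f = t ^ 2 + ∑ i ∈ Finset.univ.erase v, c i ^ 2 := by
    rw [dotProduct, ← Finset.add_sum_erase _ _ (Finset.mem_univ v), hfv,
      Finset.sum_congr rfl fun i hi => by rw [hfe i hi, ← sq]]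
    ring
  have h3 : ∑ i ∈ Finset.univ.erase v, c i ^ 2 ≤ t ^ 2 :=
    Finset.sum_sq_le_sq_sum_of_nonneg fun i _ => hc i
  rw [h2]
  have h4 := pow_le_pow_left₀ ht0 htot 2
  linarith

/-- Comparison of the potentials `p`, `x` of two graphs with the same right-hand side `c`. -/
theorem potential_sub_le {G G' : WeightedGraph V} {lam μ δ : ℝ}
    (hG : G.HasSpectralGap lam) (hG' : G'.HasSpectralGap μ) (hμ : 0 < μ) (hμl : μ ≤ lam)
    (hL : frobeniusNorm (G.laplacian - G'.laplacian) ≤ δ) {v : V} {p x c : V → ℝ}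
    (hc : ∀ i, 0 ≤ c i) (hpv : p v = 0) (hxv : x v = 0)
    (hp : ∀ i, i ≠ v → (G.laplacian *ᵥ p) i = c i)
    (hx : ∀ i, i ≠ v → (G'.laplacian *ᵥ x) i = c i) {u : V} (huv : u ≠ v) :
    |p u - x u| ≤ 2 * δ * (μ ^ 2)⁻¹ * ∑ i, c i := by
  have hδ : 0 ≤ δ := (Real.sqrt_nonneg _).trans hL
  have : Nonempty V := ⟨u⟩
  have hcenter : ∀ y : V → ℝ, ∃ a, ∑ i, (y i - a) = 0 := fun y =>
    ⟨(∑ i, y i) / Fintype.card V, by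
      rw [Finset.sum_sub_distrib, Finset.sum_const, Finset.card_univ, nsmul_eq_mul,
        mul_div_cancel₀ _ (Nat.cast_ne_zero.2 Fintype.card_ne_zero), sub_self]⟩
  obtain ⟨a, ha⟩ := hcenter p
  obtain ⟨b, hb⟩ := hcenter fun i => p i - x i
  set P : V → ℝ := fun i => p i - a
  set Q : V → ℝ := fun i => p i - x i - b
  have hLP : G.laplacian *ᵥ P = G.laplacian *ᵥ p := G.laplacian_mulVec_sub_const p a
  have hLp : G.laplacian *ᵥ p = G'.laplacian *ᵥ x := by
    have hoff : ∀ i, i ≠ v → (G.laplacian *ᵥ p) i = (G'.laplacian *ᵥ x) i := fun i hi =>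
      (hp i hi).trans (hx i hi).symm
    ext i
    by_cases hi : i = v
    · have h1 := G.sum_laplacian_mulVec p
      have h2 := G'.sum_laplacian_mulVec x
      rw [← Finset.add_sum_erase _ _ (Finset.mem_univ v)] at h1 h2
      rw [Finset.sum_congr rfl fun i hi => hoff i (Finset.ne_of_mem_erase hi)] at h1
      rw [hi]
      linarith
    · exact hoff i hi
  have hLQ : G'.laplacian *ᵥ Q = -((G.laplacian - G'.laplacian) *ᵥ P) := by
    have h1 : G'.laplacian *ᵥ Q = G'.laplacian *ᵥ (p - x) :=
      G'.laplacian_mulVec_sub_const (p - x) b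
    have h2 : G'.laplacian *ᵥ P = G'.laplacian *ᵥ p := G'.laplacian_mulVec_sub_const p a
    rw [h1, mulVec_sub, sub_mulVec, hLP, h2, hLp, neg_sub]
  have h1 := hG.sq_mul_le (hμ.le.trans hμl) ha
  rw [show (fun i => p i - a) = P from rfl, hLP] at h1
  have h2 := h1.trans (G.laplacian_mulVec_dotProduct_self_le hc hp)
  have h3 := hG'.sq_mul_le hμ.le hb
  rw [show (fun i => p i - x i - b) = Q from rfl, hLQ, neg_dotProduct_neg] at h3
  have h4 := h3.trans (dotProduct_mulVec_self_le_of_frobeniusNorm_le hL P)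
  -- A difference of two coordinates costs a factor 2 here; the other 2 in the final bound comes
  -- from the norm of `L p`.
  have hQuv : (p u - x u) ^ 2 ≤ 2 * (Q ⬝ᵥ Q) := by
    have h5 : Q u ^ 2 + Q v ^ 2 ≤ Q ⬝ᵥ Q := by
      rw [← Finset.sum_pair (f := fun i => Q i ^ 2) huv]
      simp only [dotProduct, ← sq]
      exact Finset.sum_le_sum_of_subset_of_nonneg (Finset.subset_univ _) fun _ _ _ => sq_nonneg _
    have h6 : p u - x u = Q u - Q v := by simp [Q, hpv, hxv]
    rw [h6]
    nlinarith [sq_nonneg (Q u + Q v)]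
  have hPP := dotProduct_self_nonneg' P
  have hμ2 : 0 < μ ^ 2 := pow_pos hμ 2
  have h7 : μ ^ 2 * (P ⬝ᵥ P) ≤ 2 * (∑ i, c i) ^ 2 :=
    (mul_le_mul_of_nonneg_right (pow_le_pow_left₀ hμ.le hμl 2) hPP).trans h2
  have h8 : (μ ^ 2 * (p u - x u)) ^ 2 ≤ (2 * δ * ∑ i, c i) ^ 2 := by
    calc (μ ^ 2 * (p u - x u)) ^ 2 = μ ^ 2 * (μ ^ 2 * (p u - x u) ^ 2) := by ring
      _ ≤ μ ^ 2 * (μ ^ 2 * (2 * (Q ⬝ᵥ Q))) := by gcongr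
      _ = 2 * μ ^ 2 * (μ ^ 2 * (Q ⬝ᵥ Q)) := by ring
      _ ≤ 2 * μ ^ 2 * (δ ^ 2 * (P ⬝ᵥ P)) := by gcongr
      _ = 2 * δ ^ 2 * (μ ^ 2 * (P ⬝ᵥ P)) := by ring
      _ ≤ 2 * δ ^ 2 * (2 * (∑ i, c i) ^ 2) := by gcongr
      _ = _ := by ring
  have h9 := abs_le_of_sq_le_sq h8
    (mul_nonneg (mul_nonneg zero_le_two hδ) (Finset.sum_nonneg fun i _ => hc i))
  rw [abs_mul, abs_of_pos hμ2] at h9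
  calc |p u - x u| = (μ ^ 2)⁻¹ * (μ ^ 2 * |p u - x u|) := by field_simp
    _ ≤ (μ ^ 2)⁻¹ * (2 * δ * ∑ i, c i) := by gcongr
    _ = _ := by ring

end WeightedGraph

/-! ### The hitting time estimate. -/

theorem mainTheorem1 {V : Type*} [Fintype V] [DecidableEq V]
    (G G' : WeightedGraph V)
    (hE : G'.edgeSet ⊆ G.edgeSet)
    (hconn : G'.Connected)
    (δ : ℝ) (hδ : 0 < δ)
    (hL : frobeniusNorm (G.laplacian - G'.laplacian) ≤ δ)
    (hδφ : δ < G.edgeExpansion ^ 2 / (2 * G.maxDeg))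
    (u v : V) (huv : u ≠ v) :
    G.hittingTime u v ≠ ∞ ∧ G'.hittingTime u v ≠ ∞ ∧
      |(G.hittingTime u v).toReal - (G'.hittingTime u v).toReal| ≤
        δ / G.minDeg * (G.hittingTime u v).toReal +
          12 * δ * ((G.edgeExpansion ^ 2 / (2 * G.maxDeg) - δ) ^ 2)⁻¹ * G.totalWeight := by
  have : Nontrivial V := ⟨u, v, huv⟩
  set lam := G.edgeExpansion ^ 2 / (2 * G.maxDeg) with hlam
  have hlam0 : 0 < lam := hδ.trans hδφ
  have hμ : 0 < lam - δ := sub_pos.2 hδφ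
  have hG : G.HasSpectralGap lam := G.hasSpectralGap_edgeExpansion
  have hG' : G'.HasSpectralGap (lam - δ) := hG.sub hL
  have hφ : 0 < G.edgeExpansion := by
    refine G.edgeExpansion_nonneg.lt_of_ne fun h => hlam0.ne' ?_
    rw [hlam, ← h]
    simp
  have hφd := G.edgeExpansion_le_deg
  have hd : ∀ i, 0 < G.deg i := fun i => hφ.trans_le (hφd i)
  have hmax : 0 < G.maxDeg := (hd u).trans_le (G.deg_le_maxDeg u)
  -- Singleton cuts bound the expansion by every degree. Thus `δ < deg / 2`, which keeps the degrees
  -- of `G'` positive.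
  have hlam2 : ∀ i, lam ≤ G.deg i / 2 := by
    intro i
    rw [hlam, div_le_iff₀ (by linarith)]
    have h1 := mul_le_mul (hφd i) ((hφd u).trans (G.deg_le_maxDeg u)) hφ.le (hd i).le
    linarith [sq G.edgeExpansion]
  have hdd : ∀ i, |G.deg i - G'.deg i| ≤ δ := by
    intro i
    have := abs_apply_le_of_frobeniusNorm_le hL i i
    rwa [Matrix.sub_apply, WeightedGraph.laplacian_diag, WeightedGraph.laplacian_diag] at this
  have hd' : ∀ i, 0 < G'.deg i := fun i => by
    linarith [(abs_le.1 (hdd i)).2, hlam2 i, hd i]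
  have hmin : 0 < G.minDeg := hφ.trans_le (le_ciInf hφd)
  obtain ⟨hfin, hh⟩ := hG.hittingTime_toReal hlam0 hd v
  obtain ⟨hfin', hh'⟩ := hG'.hittingTime_toReal hμ hd' v
  refine ⟨hfin u, hfin' u, ?_⟩
  set x : V → ℝ := fun i => (G.hittingTime i v).toReal
  set x' : V → ℝ := fun i => (G'.hittingTime i v).toReal
  have hxv : x v = 0 := by simp [x, WeightedGraph.hittingTime_self]
  have hxv' : x' v = 0 := by simp [x', WeightedGraph.hittingTime_self]
  obtain ⟨p, hpv, hp⟩ := hG.exists_laplacian_eq hlam0 v G'.deg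
  have hδd : ∀ i, δ ≤ δ / G.minDeg * G.deg i := fun i => by
    rw [div_mul_eq_mul_div, le_div_iff₀ hmin]
    exact mul_le_mul_of_nonneg_left (G.minDeg_le_deg i) hδ.le
  have h1 : |x u - p u| ≤ δ / G.minDeg * x u := by
    have hlin : ∀ s : ℝ, G.laplacian *ᵥ ((δ / G.minDeg) • x + s • (x - p)) =
        (δ / G.minDeg) • (G.laplacian *ᵥ x) + s • (G.laplacian *ᵥ x - G.laplacian *ᵥ p) := by
      intro s
      rw [Matrix.mulVec_add, Matrix.mulVec_smul, Matrix.mulVec_smul, Matrix.mulVec_sub]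
    -- The signs `s = 1` and `s = -1` give the two halves of the absolute value bound.
    have key : ∀ s : ℝ, |s| = 1 → 0 ≤ δ / G.minDeg * x u + s * (x u - p u) := by
      intro s hs
      refine hG.nonneg_of_laplacian_nonneg hlam0 (v := v)
        (x := (δ / G.minDeg) • x + s • (x - p)) (by simp [hxv, hpv]) (fun i hi => ?_) u
      rw [hlin]
      simp only [Pi.add_apply, Pi.smul_apply, Pi.sub_apply, smul_eq_mul, hh i hi, hp i hi]
      have h2 : |s * (G.deg i - G'.deg i)| ≤ δ := by rw [abs_mul, hs, one_mul]; exact hdd i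
      linarith [hδd i, (abs_le.1 h2).1]
    have h3 := key 1 (by simp)
    have h4 := key (-1) (by simp)
    exact abs_le.2 ⟨by linarith, by linarith⟩
  have h2 := WeightedGraph.potential_sub_le hG hG' hμ (by linarith) hL (fun i => (hd' i).le) hpv
    hxv' hp hh' huv
  -- The factor 3 is generous; `δ < deg / 2` would give 3/2.
  have h3 : ∑ i, G'.deg i ≤ 6 * G.totalWeight := by
    calc ∑ i, G'.deg i ≤ ∑ i, 3 * G.deg i := Finset.sum_le_sum fun i _ => by
          linarith [(abs_le.1 (hdd i)).1, hlam2 i, hd i]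
      _ = 6 * G.totalWeight := by rw [← Finset.mul_sum, G.sum_deg]; ring
  have h4 : 2 * δ * ((lam - δ) ^ 2)⁻¹ * ∑ i, G'.deg i ≤
      12 * δ * ((lam - δ) ^ 2)⁻¹ * G.totalWeight := by
    calc _ ≤ 2 * δ * ((lam - δ) ^ 2)⁻¹ * (6 * G.totalWeight) := by gcongr
      _ = _ := by ring
  calc |x u - x' u| = |(x u - p u) + (p u - x' u)| := by ring_nf
    _ ≤ |x u - p u| + |p u - x' u| := abs_add_le _ _
    _ ≤ _ := add_le_add h1 (h2.trans h4)
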